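/- All manifolds (Hausdorff, second countable, finite-dimensional, without boundary), metrics, almost complex structures and maps are smooth. Let $(M,J,g)$ be a nearly Kähler manifold, i.e. $J$ is an almost complex structure, $g$ is a Riemannian metric with $g(JX,JY)=g(X,Y)$, and the Levi-Civita connection $\nabla^g$ of $g$ satisfies $(\nabla^g_XJ)Y=-(\nabla^g_YJ)X$ for all vector fields $X,Y$. Write $N_J(X,Y)=[JX,JY]-[X,Y]-J[X,JY]-J[JX,Y]$. For a bilinear map $B$ on a tangent space of $M$ with values in a vector space, let $B^{1,1}(X,Y)=\tfrac12\big(B(X,Y)+B(JX,JY)\big)$ be its $(1,1)$-part. A complex connection of Nijenhuis type on $(M,J)$ is a connection $D$ on $TM$ with $DJ=0$ whose torsion $T^D(X,Y)=D_XY-D_YX-[X,Y]$ satisfies $(T^D)^{1,1}=0$. (i) There is a connection $\overline\nabla$ on $TM$ with $\overline\nabla J=0$, $\overline\nabla g=0$ and totally skew-symmetric torsion $\overline T$ (that is, $g(\overline T(X,Y),Z)$ is alternating in $X,Y,Z$), a characteristic connection. (ii) For every such $\overline\nabla$ one has $N_J(X,Y)=4(\nabla^g_XJ)JY=4\,\overline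 T(X,Y)$, and $\overline\nabla$ is a complex connection of Nijenhuis type. Moreover $\overline\nabla_XY-\nabla^g_XY=\tfrac12\overline T(X,Y)$; this difference tensor is skew-symmetric in $X,Y$, and therefore trace-free: $\mathrm{Tr}_g(\nabla^g_\cdot\,\cdot-\overline\nabla_\cdot\,\cdot)=0$. (iii) Let $(N,h)$ be a pseudo-Riemannian manifold with Levi-Civita connection $\nabla^h$, and let $\phi:M\to N$ be smooth. For a connection $D$ on $TM$ put $(\nabla^{D}d\phi)(X,Y)=(\phi^*\nabla^h)_X(d\phi(Y))-d\phi(D_XY)$. If $\phi$ is generalized pluriharmonic, i.e. $(\nabla^{D}d\phi)^{1,1}=0$ for some complex connection $D$ of Nijenhuis type on $(M,J)$, then $\phi$ is harmonic, i.e. it satisfies the harmonic map equation $\mathrm{Tr}_g(\nabla^{\nabla^g}d\phi)=0$. -/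

import Mathlib

open Bundle Set FiberBundle VectorField
open scoped Manifold ContDiff Topology

noncomputable section

namespace NearlyKahler

/-- A connection on the tangent bundle of a manifold `M` modelled on `E`. Argument order:
`D Y x u` is the covariant derivative of the vector field `Y` at `x` in the direction `u`. No
regularity of `D` is imposed. -/
abbrev Connection (E : Type*) [NormedAddCommGroup E] [NormedSpace ℝ E]
    (M : Type*) [TopologicalSpace M] [ChartedSpace E M] [IsManifold 𝓘(ℝ, E) ∞ M] :=
  CovariantDerivative 𝓘(ℝ, E) E (fun x : M ↦ TangentSpace 𝓘(ℝ, E) x)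

/-- A smooth pseudo-Riemannian metric on `M`: a smooth field of nondegenerate symmetric
bilinear forms on the tangent spaces. -/
structure PseudoMetric (E : Type*) [NormedAddCommGroup E] [NormedSpace ℝ E]
    (M : Type*) [TopologicalSpace M] [ChartedSpace E M] [IsManifold 𝓘(ℝ, E) ∞ M] where
  /-- the bilinear form on the tangent space at `x` -/
  form (x : M) : TangentSpace 𝓘(ℝ, E) x →L[ℝ] TangentSpace 𝓘(ℝ, E) x →L[ℝ] ℝ
  symm (x : M) (u v : TangentSpace 𝓘(ℝ, E) x) : form x u v = form x v u
  nondegenerate (x : M) (u : TangentSpace 𝓘(ℝ, E) x) (h : ∀ v, form x u v = 0) : u = 0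
  smooth : ContMDiff 𝓘(ℝ, E) (𝓘(ℝ, E).prod 𝓘(ℝ, E →L[ℝ] E →L[ℝ] ℝ)) ∞
    (fun x ↦ TotalSpace.mk' (E →L[ℝ] E →L[ℝ] ℝ)
      (E := fun x : M ↦ TangentSpace 𝓘(ℝ, E) x →L[ℝ] TangentSpace 𝓘(ℝ, E) x →L[ℝ] ℝ) x (form x))

/-- A smooth almost complex structure on `M`. -/
structure AlmostComplex (E : Type*) [NormedAddCommGroup E] [NormedSpace ℝ E]
    (M : Type*) [TopologicalSpace M] [ChartedSpace E M] [IsManifold 𝓘(ℝ, E) ∞ M] where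
  /-- the endomorphism of the tangent space at `x` -/
  J (x : M) : TangentSpace 𝓘(ℝ, E) x →L[ℝ] TangentSpace 𝓘(ℝ, E) x
  sq (x : M) (u : TangentSpace 𝓘(ℝ, E) x) : J x (J x u) = -u
  smooth : ContMDiff 𝓘(ℝ, E) (𝓘(ℝ, E).prod 𝓘(ℝ, E →L[ℝ] E)) ∞
    (fun x ↦ TotalSpace.mk' (E →L[ℝ] E)
      (E := fun x : M ↦ TangentSpace 𝓘(ℝ, E) x →L[ℝ] TangentSpace 𝓘(ℝ, E) x) x (J x))

set_option linter.unusedSectionVars false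

section Source

variable {E : Type*} [NormedAddCommGroup E] [NormedSpace ℝ E] [FiniteDimensional ℝ E]
  {M : Type*} [TopologicalSpace M] [ChartedSpace E M] [IsManifold 𝓘(ℝ, E) ∞ M]

/-- `D` preserves `g`: `X g(Y, Z) = g(D_X Y, Z) + g(Y, D_X Z)`. -/
def IsMetric (g : PseudoMetric E M) (D : Connection E M) : Prop :=
  ∀ (x : M) (Y Z : Π y : M, TangentSpace 𝓘(ℝ, E) y), MDiffAt (T% Y) x → MDiffAt (T% Z) x →
    ∀ u : TangentSpace 𝓘(ℝ, E) x,
      mvfderiv 𝓘(ℝ, E) (fun y ↦ g.form y (Y y) (Z y)) x u =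
        g.form x (D Y x u) (Z x) + g.form x (Y x) (D Z x u)

/-- The Levi-Civita condition: torsion-free and metric. -/
def IsLeviCivita (g : PseudoMetric E M) (D : Connection E M) : Prop :=
  D.torsion = 0 ∧ IsMetric g D

section Koszul

/-- The right-hand side of the Koszul formula for `2 g(∇_X Y, Z)`. -/
def koszul (g : PseudoMetric E M) (X Y Z : Π y : M, TangentSpace 𝓘(ℝ, E) y) (x : M) : ℝ :=
  mvfderiv 𝓘(ℝ, E) (fun y ↦ g.form y (Y y) (Z y)) x (X x)
    + mvfderiv 𝓘(ℝ, E) (fun y ↦ g.form y (X y) (Z y)) x (Y x)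
    - mvfderiv 𝓘(ℝ, E) (fun y ↦ g.form y (X y) (Y y)) x (Z x)
    + g.form x (mlieBracket 𝓘(ℝ, E) X Y x) (Z x)
    - g.form x (mlieBracket 𝓘(ℝ, E) X Z x) (Y x)
    - g.form x (mlieBracket 𝓘(ℝ, E) Y Z x) (X x)

variable (g : PseudoMetric E M) {X Y Z X' Y' Z' : Π y : M, TangentSpace 𝓘(ℝ, E) y} {x : M}
  {f : M → ℝ}

theorem mdiffAt_form (hY : MDiffAt (T% Y) x) (hZ : MDiffAt (T% Z) x) :
    MDiffAt (fun y ↦ g.form y (Y y) (Z y)) x := by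
  have : MDifferentiableAt 𝓘(ℝ, E) (𝓘(ℝ, E).prod 𝓘(ℝ))
      (fun m ↦ TotalSpace.mk' ℝ (E := Bundle.Trivial M ℝ) m (g.form m (Y m) (Z m))) x := by
    apply MDifferentiableAt.clm_bundle_apply₂ (F₁ := E) (F₂ := E)
    · exact g.smooth.mdifferentiableAt (by simp)
    · exact hY
    · exact hZ
  simp only [mdifferentiableAt_totalSpace] at this
  exact this.2

theorem mvfderiv_form_add (hY : MDiffAt (T% Y) x) (hY' : MDiffAt (T% Y') x)
    (hZ : MDiffAt (T% Z) x) :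
    mvfderiv 𝓘(ℝ, E) (fun y ↦ g.form y ((Y + Y') y) (Z y)) x =
      mvfderiv 𝓘(ℝ, E) (fun y ↦ g.form y (Y y) (Z y)) x
        + mvfderiv 𝓘(ℝ, E) (fun y ↦ g.form y (Y' y) (Z y)) x := by
  have h := mvfderiv_add (mdiffAt_form g hY hZ) (mdiffAt_form g hY' hZ)
  simp only [Pi.add_def] at h
  simp only [Pi.add_apply, map_add, add_apply]
  exact h

theorem mvfderiv_form_smul (hf : MDiffAt f x) (hY : MDiffAt (T% Y) x) (hZ : MDiffAt (T% Z) x)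
    (u : TangentSpace 𝓘(ℝ, E) x) :
    mvfderiv 𝓘(ℝ, E) (fun y ↦ g.form y ((f • Y) y) (Z y)) x u =
      f x * mvfderiv 𝓘(ℝ, E) (fun y ↦ g.form y (Y y) (Z y)) x u
        + mvfderiv 𝓘(ℝ, E) f x u * g.form x (Y x) (Z x) := by
  have h := mvfderiv_mul hf (mdiffAt_form g hY hZ)
  simp only [Pi.mul_def] at h
  simp only [Pi.smul_apply', map_smul, smul_apply, smul_eq_mul]
  rw [h]
  simp [mul_comm]

theorem form_comm (Y Z : Π y : M, TangentSpace 𝓘(ℝ, E) y) :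
    (fun y ↦ g.form y (Y y) (Z y)) = fun y ↦ g.form y (Z y) (Y y) :=
  funext fun y ↦ g.symm y _ _

theorem koszul_swap₁₂ (X Y Z : Π y : M, TangentSpace 𝓘(ℝ, E) y) (x : M) :
    koszul g X Y Z x - koszul g Y X Z x = 2 * g.form x (mlieBracket 𝓘(ℝ, E) X Y x) (Z x) := by
  simp only [koszul]
  rw [form_comm g Y X, mlieBracket_swap_apply (V := Y) (W := X)]
  simp only [map_neg, neg_apply]
  ring

theorem koszul_swap₂₃ (X Y Z : Π y : M, TangentSpace 𝓘(ℝ, E) y) (x : M) :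
    koszul g X Y Z x + koszul g X Z Y x =
      2 * mvfderiv 𝓘(ℝ, E) (fun y ↦ g.form y (Y y) (Z y)) x (X x) := by
  simp only [koszul]
  rw [form_comm g Z Y, mlieBracket_swap_apply (V := Z) (W := Y)]
  simp only [map_neg, neg_apply]
  ring

theorem koszul_add₂ (hX : MDiffAt (T% X) x) (hY : MDiffAt (T% Y) x)
    (hY' : MDiffAt (T% Y') x) (hZ : MDiffAt (T% Z) x) :
    koszul g X (Y + Y') Z x = koszul g X Y Z x + koszul g X Y' Z x := by
  simp only [koszul, mlieBracket_add_left hY hY', mlieBracket_add_right hY hY',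
    mvfderiv_form_add g hY hY' hZ]
  rw [form_comm g X (Y + Y'), mvfderiv_form_add g hY hY' hX, form_comm g Y X, form_comm g Y' X]
  simp only [Pi.add_apply, map_add, add_apply]
  ring

theorem koszul_smul₂ (hf : MDiffAt f x) (hX : MDiffAt (T% X) x) (hY : MDiffAt (T% Y) x)
    (hZ : MDiffAt (T% Z) x) :
    koszul g X (f • Y) Z x =
      f x * koszul g X Y Z x + 2 * mvfderiv 𝓘(ℝ, E) f x (X x) * g.form x (Y x) (Z x) := by
  simp only [koszul, mlieBracket_smul_left hf hY, mlieBracket_smul_right hf hY,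
    mvfderiv_form_smul g hf hY hZ]
  rw [form_comm g X (f • Y), mvfderiv_form_smul g hf hY hX, form_comm g Y X]
  simp only [Pi.smul_apply', map_add, map_smul, add_apply, smul_apply, smul_eq_mul]
  ring

theorem koszul_add₃ (hX : MDiffAt (T% X) x) (hY : MDiffAt (T% Y) x)
    (hZ : MDiffAt (T% Z) x) (hZ' : MDiffAt (T% Z') x) :
    koszul g X Y (Z + Z') x = koszul g X Y Z x + koszul g X Y Z' x := by
  have h := koszul_swap₂₃ g X Y (Z + Z') x
  rw [koszul_add₂ g hX hZ hZ' hY, form_comm g Y, mvfderiv_form_add g hZ hZ' hY,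
    form_comm g Z, form_comm g Z', add_apply] at h
  linarith [koszul_swap₂₃ g X Y Z x, koszul_swap₂₃ g X Y Z' x]

theorem koszul_smul₃ (hf : MDiffAt f x) (hX : MDiffAt (T% X) x) (hY : MDiffAt (T% Y) x)
    (hZ : MDiffAt (T% Z) x) :
    koszul g X Y (f • Z) x = f x * koszul g X Y Z x := by
  have h := koszul_swap₂₃ g X Y (f • Z) x
  rw [koszul_smul₂ g hf hX hZ hY, form_comm g Y, mvfderiv_form_smul g hf hZ hY,
    form_comm g Z] at h
  linear_combination h - f x * koszul_swap₂₃ g X Y Z x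

theorem koszul_add₁ (hX : MDiffAt (T% X) x) (hX' : MDiffAt (T% X') x)
    (hY : MDiffAt (T% Y) x) (hZ : MDiffAt (T% Z) x) :
    koszul g (X + X') Y Z x = koszul g X Y Z x + koszul g X' Y Z x := by
  have h := koszul_swap₁₂ g (X + X') Y Z x
  rw [koszul_add₂ g hY hX hX' hZ, mlieBracket_add_left hX hX', map_add, add_apply] at h
  linarith [koszul_swap₁₂ g X Y Z x, koszul_swap₁₂ g X' Y Z x]

theorem koszul_smul₁ (hf : MDiffAt f x) (hX : MDiffAt (T% X) x) (hY : MDiffAt (T% Y) x)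
    (hZ : MDiffAt (T% Z) x) :
    koszul g (f • X) Y Z x = f x * koszul g X Y Z x := by
  have h := koszul_swap₁₂ g (f • X) Y Z x
  rw [koszul_smul₂ g hf hY hX hZ, mlieBracket_smul_left hf hX, map_add, add_apply,
    map_smul, map_smul, smul_apply, smul_apply, smul_eq_mul, smul_eq_mul] at h
  linear_combination h - f x * koszul_swap₁₂ g X Y Z x

/-- For `Y` differentiable at `x`, the Koszul expression as a bilinear form in `(X, Z)` at `x`. -/
def koszulForm (Y : Π y : M, TangentSpace 𝓘(ℝ, E) y) (x : M) (hY : MDiffAt (T% Y) x) :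
    TangentSpace 𝓘(ℝ, E) x →L[ℝ] TangentSpace 𝓘(ℝ, E) x →L[ℝ] ℝ :=
  TensorialAt.mkHom₂ (I := 𝓘(ℝ, E)) (F := E) (F' := E) (fun X Z ↦ koszul g X Y Z x) x
    (fun _ hZ ↦ ⟨fun hf hX ↦ koszul_smul₁ g hf hX hY hZ,
      fun hX hX' ↦ koszul_add₁ g hX hX' hY hZ⟩)
    (fun _ hX ↦ ⟨fun hf hZ ↦ koszul_smul₃ g hf hX hY hZ,
      fun hZ hZ' ↦ koszul_add₃ g hX hY hZ hZ'⟩)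

theorem koszulForm_apply (hX : MDiffAt (T% X) x) (hY : MDiffAt (T% Y) x)
    (hZ : MDiffAt (T% Z) x) : koszulForm g Y x hY (X x) (Z x) = koszul g X Y Z x :=
  TensorialAt.mkHom₂_apply _ _ hX hZ

instance (x : M) : FiniteDimensional ℝ (TangentSpace 𝓘(ℝ, E) x) :=
  inferInstanceAs (FiniteDimensional ℝ E)

instance (x : M) : T2Space (TangentSpace 𝓘(ℝ, E) x) :=
  inferInstanceAs (T2Space E)

/-- The isomorphism between the tangent space and its dual given by the metric. -/
def flat (x : M) :
    TangentSpace 𝓘(ℝ, E) x ≃L[ℝ] (TangentSpace 𝓘(ℝ, E) x →L[ℝ] ℝ) :=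
  (LinearEquiv.ofInjectiveOfFinrankEq (g.form x).toLinearMap
    ((injective_iff_map_eq_zero _).2 fun u hu ↦ g.nondegenerate x u fun v ↦ by
      simpa using congr($hu v))
    (by
      rw [← (LinearMap.toContinuousLinearMap (𝕜 := ℝ) (E := TangentSpace 𝓘(ℝ, E) x)
        (F' := ℝ)).finrank_eq]
      exact (Subspace.dual_finrank_eq (K := ℝ) (V := TangentSpace 𝓘(ℝ, E) x)).symm)
    ).toContinuousLinearEquiv

theorem flat_apply (u : TangentSpace 𝓘(ℝ, E) x) : flat g x u = g.form x u := rfl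

theorem form_flat_symm (l : TangentSpace 𝓘(ℝ, E) x →L[ℝ] ℝ) :
    g.form x ((flat g x).symm l) = l := by
  rw [← flat_apply, ContinuousLinearEquiv.apply_symm_apply]

theorem form_ext {u v : TangentSpace 𝓘(ℝ, E) x} (h : ∀ w, g.form x u w = g.form x v w) :
    u = v := (flat g x).injective (ContinuousLinearMap.ext h)

open Classical in
/-- The connection defined by the Koszul formula. -/
def koszulFun (Y : Π y : M, TangentSpace 𝓘(ℝ, E) y) (x : M) :
    TangentSpace 𝓘(ℝ, E) x →L[ℝ] TangentSpace 𝓘(ℝ, E) x :=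
  if hY : MDiffAt (T% Y) x then
    ((flat g x).symm : (TangentSpace 𝓘(ℝ, E) x →L[ℝ] ℝ) →L[ℝ] TangentSpace 𝓘(ℝ, E) x).comp
      ((1 / 2 : ℝ) • koszulForm g Y x hY)
  else 0

theorem form_koszulFun (hX : MDiffAt (T% X) x) (hY : MDiffAt (T% Y) x) (hZ : MDiffAt (T% Z) x) :
    g.form x (koszulFun g Y x (X x)) (Z x) = 1 / 2 * koszul g X Y Z x := by
  rw [koszulFun, dif_pos hY, ← koszulForm_apply g hX hY hZ]
  simp [form_flat_symm]

theorem form_koszulFun' (hY : MDiffAt (T% Y) x) (u w : TangentSpace 𝓘(ℝ, E) x) :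
    g.form x (koszulFun g Y x u) w = 1 / 2 * koszul g (extend E u) Y (extend E w) x := by
  have h := form_koszulFun g (mdifferentiableAt_extend 𝓘(ℝ, E) E u) hY
    (mdifferentiableAt_extend 𝓘(ℝ, E) E w)
  simpa using h

/-- The Levi-Civita connection of a pseudo-Riemannian metric, defined by the Koszul formula. -/
def leviCivita (g : PseudoMetric E M) : Connection E M where
  toFun := koszulFun g
  isCovariantDerivativeOnUniv :=
    { add := fun {Y Y' x} hY hY' _ ↦ by
        ext1 u
        refine form_ext g fun w ↦ ?_
        rw [add_apply, map_add, add_apply, form_koszulFun' g (mdifferentiableAt_add_section hY hY'),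
          form_koszulFun' g hY, form_koszulFun' g hY',
          koszul_add₂ g (mdifferentiableAt_extend 𝓘(ℝ, E) E u) hY hY'
            (mdifferentiableAt_extend 𝓘(ℝ, E) E w)]
        ring
      leibniz := fun {Y f x} hY hf _ ↦ by
        ext1 u
        refine form_ext g fun w ↦ ?_
        rw [add_apply, map_add, add_apply, form_koszulFun' g (hf.smul_section hY),
          koszul_smul₂ g hf (mdifferentiableAt_extend 𝓘(ℝ, E) E u) hY
            (mdifferentiableAt_extend 𝓘(ℝ, E) E w), smul_apply, map_smul, smul_apply,
          form_koszulFun' g hY]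
        simp
        ring }

theorem isLeviCivita_leviCivita (g : PseudoMetric E M) : IsLeviCivita g (leviCivita g) := by
  constructor
  · rw [CovariantDerivative.torsion_eq_zero_iff]
    intro X Y x hX hY
    refine form_ext g fun w ↦ ?_
    have h1 := form_koszulFun g hX hY (mdifferentiableAt_extend 𝓘(ℝ, E) E w)
    have h2 := form_koszulFun g hY hX (mdifferentiableAt_extend 𝓘(ℝ, E) E w)
    have h3 := koszul_swap₁₂ g X Y (extend E w) x
    simp only [extend_apply_self] at h1 h2 h3
    rw [map_sub, sub_apply]
    change g.form x (koszulFun g Y x (X x)) w - g.form x (koszulFun g X x (Y x)) w = _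
    linarith
  · intro x Y Z hY hZ u
    have h1 := form_koszulFun g (mdifferentiableAt_extend 𝓘(ℝ, E) E u) hY hZ
    have h2 := form_koszulFun g (mdifferentiableAt_extend 𝓘(ℝ, E) E u) hZ hY
    have h3 := koszul_swap₂₃ g (extend E u) Y Z x
    simp only [extend_apply_self] at h1 h2 h3
    rw [g.symm x (Y x)]
    change _ = g.form x (koszulFun g Y x u) (Z x) + g.form x (koszulFun g Z x u) (Y x)
    linarith

end Koszul
/-- `(∇_X J) Y = ∇_X (J Y) - J (∇_X Y)`. -/
def nablaJ (D : Connection E M) (𝓙 : AlmostComplex E M)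
    (X Y : Π y : M, TangentSpace 𝓘(ℝ, E) y) (x : M) : TangentSpace 𝓘(ℝ, E) x :=
  D (fun y ↦ 𝓙.J y (Y y)) x (X x) - 𝓙.J x (D Y x (X x))

/-- A complex connection: `∇J = 0`. -/
def IsComplex (𝓙 : AlmostComplex E M) (D : Connection E M) : Prop :=
  ∀ (x : M) (X Y : Π y : M, TangentSpace 𝓘(ℝ, E) y), MDiffAt (T% X) x → MDiffAt (T% Y) x →
    nablaJ D 𝓙 X Y x = 0

/-- The part of type `(1,1)` of a bilinear map `B` on a tangent space with respect to the complex
structure: `B^{1,1}(u, v) = (B(u, v) + B(Ju, Jv)) / 2`. Its complex bilinear extension agrees with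
that of `B` on pairs of vectors of types `(1,0)` and `(0,1)` (in either order), and vanishes on
pairs of vectors of equal type. -/
def part11 (𝓙 : AlmostComplex E M) {x : M} {W : Type*} [AddCommGroup W] [Module ℝ W]
    (B : TangentSpace 𝓘(ℝ, E) x → TangentSpace 𝓘(ℝ, E) x → W)
    (u v : TangentSpace 𝓘(ℝ, E) x) : W :=
  (1 / 2 : ℝ) • (B u v + B (𝓙.J x u) (𝓙.J x v))

/-- A complex connection of Nijenhuis type: the `(1,1)`-part of the torsion vanishes. -/
def IsNijenhuisType (𝓙 : AlmostComplex E M) (D : Connection E M) : Prop :=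
  IsComplex 𝓙 D ∧
    ∀ (x : M) (u v : TangentSpace 𝓘(ℝ, E) x), part11 𝓙 (fun a b ↦ D.torsion x a b) u v = 0

/-- The Nijenhuis tensor `N_J(X, Y) = [JX, JY] - [X, Y] - J[X, JY] - J[JX, Y]`. -/
def nijenhuis (𝓙 : AlmostComplex E M) (X Y : Π y : M, TangentSpace 𝓘(ℝ, E) y) (x : M) :
    TangentSpace 𝓘(ℝ, E) x :=
  mlieBracket 𝓘(ℝ, E) (fun y ↦ 𝓙.J y (X y)) (fun y ↦ 𝓙.J y (Y y)) x
    - mlieBracket 𝓘(ℝ, E) X Y x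
    - 𝓙.J x (mlieBracket 𝓘(ℝ, E) X (fun y ↦ 𝓙.J y (Y y)) x)
    - 𝓙.J x (mlieBracket 𝓘(ℝ, E) (fun y ↦ 𝓙.J y (X y)) Y x)

/-- `(M, J, g)` is almost Hermitian: `g` is positive definite and `J^* g = g`. -/
structure IsAlmostHermitian (g : PseudoMetric E M) (𝓙 : AlmostComplex E M) : Prop where
  pos (x : M) (u : TangentSpace 𝓘(ℝ, E) x) : u ≠ 0 → 0 < g.form x u u
  compat (x : M) (u v : TangentSpace 𝓘(ℝ, E) x) :
    g.form x (𝓙.J x u) (𝓙.J x v) = g.form x u v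

/-- `(M, J, g)` is nearly Kähler: it is almost Hermitian and `(∇_X J) Y = -(∇_Y J) X` for the
Levi-Civita connection `∇` of `g`. -/
structure IsNearlyKahler (g : PseudoMetric E M) (𝓙 : AlmostComplex E M) : Prop
    extends IsAlmostHermitian g 𝓙 where
  skew (x : M) (X Y : Π y : M, TangentSpace 𝓘(ℝ, E) y) (hX : MDiffAt (T% X) x)
    (hY : MDiffAt (T% Y) x) :
    nablaJ (leviCivita g) 𝓙 X Y x = -nablaJ (leviCivita g) 𝓙 Y X x

/-- A characteristic connection: complex, metric, and with totally skew-symmetric torsion, i.e.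
`(u, v, w) ↦ g(T(u, v), w)` is alternating (skewness in `u, v` holds for every torsion). -/
structure IsCharacteristic (g : PseudoMetric E M) (𝓙 : AlmostComplex E M)
    (D : Connection E M) : Prop where
  complex : IsComplex 𝓙 D
  metric : IsMetric g D
  skew (x : M) (u v w : TangentSpace 𝓘(ℝ, E) x) :
    g.form x (D.torsion x u v) w = -g.form x (D.torsion x u w) v

/-- The trace `Tr_g B = ∑ g^{ij} B(b_i, b_j)` of a bilinear map on the tangent space at `x`, where
`g^{ij}` is the inverse of the Gram matrix of a basis `b`. -/
def metricTrace (g : PseudoMetric E M) (x : M) {W : Type*} [AddCommGroup W] [Module ℝ W]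
    (B : TangentSpace 𝓘(ℝ, E) x → TangentSpace 𝓘(ℝ, E) x → W) : W :=
  let b := Module.finBasis ℝ (TangentSpace 𝓘(ℝ, E) x)
  ∑ i, ∑ j, ((Matrix.of fun k l ↦ g.form x (b k) (b l))⁻¹ i j) • B (b i) (b j)

end Source

section Maps

variable {E : Type*} [NormedAddCommGroup E] [NormedSpace ℝ E] [FiniteDimensional ℝ E]
  {M : Type*} [TopologicalSpace M] [ChartedSpace E M] [IsManifold 𝓘(ℝ, E) ∞ M]
  {F : Type*} [NormedAddCommGroup F] [NormedSpace ℝ F] [FiniteDimensional ℝ F]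
  {N : Type*} [TopologicalSpace N] [ChartedSpace F N] [IsManifold 𝓘(ℝ, F) ∞ N]

/-- The pull-back connection `φ^*∇` on `φ^*TN`, applied to a section `s` of `φ^*TN` at `x`.
Let `e` be the trivialization of `TN` around `φ x`, with frame `(e_a)`, and `s = ∑ s^a (e_a ∘ φ)`
near `x`. Then `(φ^*∇)_u s = ∑ ds^a(u) e_a + ∇_{dφ(u)} (∑ s^a(x) e_a)`; here
`extend F (s x)` is the local field `∑ s^a(x) e_a`. -/
def pullbackConnection (D : Connection F N) (φ : M → N)
    (s : Π y : M, TangentSpace 𝓘(ℝ, F) (φ y)) (x : M) :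
    TangentSpace 𝓘(ℝ, E) x →L[ℝ] TangentSpace 𝓘(ℝ, F) (φ x) :=
  ((trivializationAt F (fun z : N ↦ TangentSpace 𝓘(ℝ, F) z) (φ x)).symmL ℝ (φ x)).comp
      (mvfderiv 𝓘(ℝ, E) (fun y ↦ (trivializationAt F (fun z : N ↦ TangentSpace 𝓘(ℝ, F) z) (φ x)
        (TotalSpace.mk' F (φ y) (s y))).2) x)
    + (D (extend F (s x)) (φ x)).comp (mfderiv 𝓘(ℝ, E) 𝓘(ℝ, F) φ x)

/-- `(∇dφ)(u, v) = (φ^*∇')_u (dφ(V)) - dφ(D_u V)`, for the connection `∇` on `T^*M ⊗ φ^*TN` induced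
by `D` on `M` and `∇'` on `N`. Here `V` is any differentiable field with value `v` at `x`; we use
the one that is constant in the trivialization of `TM` around `x`. -/
def nablaDiff (D : Connection E M) (D' : Connection F N) (φ : M → N) (x : M)
    (u v : TangentSpace 𝓘(ℝ, E) x) : TangentSpace 𝓘(ℝ, F) (φ x) :=
  pullbackConnection (E := E) D' φ
      (fun y ↦ mfderiv 𝓘(ℝ, E) 𝓘(ℝ, F) φ y (extend E v y)) x u
    - mfderiv 𝓘(ℝ, E) 𝓘(ℝ, F) φ x (D (extend E v) x u)

/-- `φ : (M, J) → (N, h)` is generalized pluriharmonic: `(∇dφ)^{1,1} = 0`, where `∇` is induced by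
a complex connection `D` of Nijenhuis type on `M` and the Levi-Civita connection of `h`. -/
def IsGeneralizedPluriharmonic (𝓙 : AlmostComplex E M) (h : PseudoMetric F N) (φ : M → N) : Prop :=
  ∃ D : Connection E M, IsNijenhuisType 𝓙 D ∧
    ∀ (x : M) (u v : TangentSpace 𝓘(ℝ, E) x),
      part11 𝓙 (nablaDiff D (leviCivita h) φ x) u v = 0

/-- `φ : (M, g) → (N, h)` is harmonic: it solves the harmonic map equation `Tr_g ∇dφ = 0`, where
`∇` is induced by the Levi-Civita connections of `g` and `h`. -/
def IsHarmonic (g : PseudoMetric E M) (h : PseudoMetric F N) (φ : M → N) : Prop :=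
  ∀ x : M, metricTrace g x (nablaDiff (leviCivita g) (leviCivita h) φ x) = 0

end Maps

end NearlyKahler

end

namespace NearlyKahler

set_option linter.unusedSectionVars false

/-! Write `A(u, v)` for the difference `D_u v - ∇_u v` of a connection from Levi-Civita. Existence:
`D = (∇ - J∇J)/2` makes `J` parallel and remains metric. Here `A(u, v) = -J(∇_u J)v / 2`, which the
nearly Kähler identity makes skew in `u, v`. Hence the torsion is `2A`, and since both connections
are metric it is also skew in the last two slots (`isCharacteristic_complexification`).

For any characteristic connection with torsion `T`, Koszul's permutation argument gives `A = T/2`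
(`difference_eq_half_torsion`). Then `DJ = 0` expresses `∇J` through `T`, and the nearly Kähler
identity becomes `T(u, Jv) = T(Ju, v)`. Total skewness upgrades this to `T(u, Jv) = -J T(u, v)`
(`torsion_J_right`). The formulas for `N_J` and `(∇J)J`, and the vanishing of the `(1,1)`-part of
`T`, are then algebra.

Harmonicity: as `J` is an isometry, `Tr_g B` depends only on the values `B(u, u) + B(Ju, Ju)`
(`metricTrace_eq_zero`). On these values `∇dφ` is the same for all the connections involved:
Levi-Civita and a characteristic connection differ by a skew tensor, and two connections of
Nijenhuis type differ by a tensor `S` with `S(u, u) + S(Ju, Ju) = 0` (`difference_self_add_J`).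
Pluriharmonicity makes them zero. -/

theorem sum_sum_sum_sum_reverse {ι W : Type*} [Fintype ι] [AddCommMonoid W]
    (f : ι → ι → ι → ι → W) :
    ∑ i, ∑ j, ∑ l, ∑ k, f i j k l = ∑ k, ∑ l, ∑ j, ∑ i, f i j k l := by
  simp_rw [Finset.sum_comm (f := fun l k ↦ f _ _ k l)]
  simp_rw [Finset.sum_comm (f := fun j k ↦ ∑ l, f _ j k l)]
  rw [Finset.sum_comm]
  refine Finset.sum_congr rfl fun k _ ↦ ?_
  simp_rw [Finset.sum_comm (f := fun j l ↦ f _ j k l)]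
  rw [Finset.sum_comm]
  exact Finset.sum_congr rfl fun l _ ↦ Finset.sum_comm

/-! ### Almost Hermitian algebra, difference tensors and the complexified connection. -/

section Source

variable {E : Type*} [NormedAddCommGroup E] [NormedSpace ℝ E] [FiniteDimensional ℝ E]
  {M : Type*} [TopologicalSpace M] [ChartedSpace E M] [IsManifold 𝓘(ℝ, E) ∞ M]

theorem mdiffAt_J (𝓙 : AlmostComplex E M) {Y : Π y : M, TangentSpace 𝓘(ℝ, E) y} {x : M}
    (hY : MDiffAt (T% Y) x) : MDiffAt (T% fun y ↦ 𝓙.J y (Y y)) x :=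
  MDifferentiableAt.clm_bundle_apply (F₁ := E) (F₂ := E)
    (𝓙.smooth.mdifferentiableAt (by simp)) hY

theorem form_J_left {g : PseudoMetric E M} {𝓙 : AlmostComplex E M}
    (h : IsAlmostHermitian g 𝓙) (x : M) (u v : TangentSpace 𝓘(ℝ, E) x) :
    g.form x (𝓙.J x u) v = -g.form x u (𝓙.J x v) := by
  have := h.compat x u (𝓙.J x v)
  rw [𝓙.sq, map_neg] at this
  linarith

section Connection

variable (D : Connection E M) {Y Y' : Π y : M, TangentSpace 𝓘(ℝ, E) y} {x : M}

theorem connection_neg (hY : MDiffAt (T% Y) x) : D (fun y ↦ -Y y) x = -D Y x := by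
  have h := D.isCovariantDerivativeOnUniv.smul_const (-1) hY
  rw [neg_one_smul, neg_one_smul] at h
  exact h

theorem connection_J_J (𝓙 : AlmostComplex E M) (hY : MDiffAt (T% Y) x) :
    D (fun y ↦ 𝓙.J y (𝓙.J y (Y y))) x = -D Y x := by
  simp only [𝓙.sq]
  exact connection_neg D hY

theorem connection_eq_add_difference (D' : Connection E M) (hY : MDiffAt (T% Y) x)
    (u : TangentSpace 𝓘(ℝ, E) x) :
    D Y x u = D' Y x u + D.difference D' x (Y x) u := by
  have h := IsCovariantDerivativeOn.difference_apply D.isCovariantDerivativeOnUniv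
    D'.isCovariantDerivativeOnUniv (x := x) (by trivial) hY
  have h' : D.difference D' x (Y x) = D Y x - D' Y x := h
  rw [h']
  simp

theorem difference_sub_swap (D' : Connection E M) (x : M) (u v : TangentSpace 𝓘(ℝ, E) x) :
    D.difference D' x v u - D.difference D' x u v = D.torsion x u v - D'.torsion x u v := by
  have hu := mdifferentiableAt_extend 𝓘(ℝ, E) E u
  have hv := mdifferentiableAt_extend 𝓘(ℝ, E) E v
  rw [D.torsion_apply_eq_extend, D'.torsion_apply_eq_extend,
    connection_eq_add_difference D D' hu, connection_eq_add_difference D D' hv]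
  simp only [extend_apply_self]
  abel

/-- Both connections expand the same derivative of `g(V, W)`, so the terms in the difference tensor
must cancel. -/
theorem form_difference_skew {g : PseudoMetric E M} {D D' : Connection E M} (hD : IsMetric g D)
    (hD' : IsMetric g D') (x : M) (u v w : TangentSpace 𝓘(ℝ, E) x) :
    g.form x (D.difference D' x v u) w = -g.form x v (D.difference D' x w u) := by
  have hv := mdifferentiableAt_extend 𝓘(ℝ, E) E v
  have hw := mdifferentiableAt_extend 𝓘(ℝ, E) E w
  have h := hD x _ _ hv hw u
  rw [hD' x _ _ hv hw u, connection_eq_add_difference D D' hv,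
    connection_eq_add_difference D D' hw] at h
  simp only [extend_apply_self, map_add, add_apply] at h
  linarith

/-- For complex connections, the difference tensor is complex linear in the differentiated
argument. -/
theorem difference_J {𝓙 : AlmostComplex E M} {D D' : Connection E M} (hD : IsComplex 𝓙 D)
    (hD' : IsComplex 𝓙 D') (x : M) (u v : TangentSpace 𝓘(ℝ, E) x) :
    D.difference D' x (𝓙.J x v) u = 𝓙.J x (D.difference D' x v u) := by
  have hu := mdifferentiableAt_extend 𝓘(ℝ, E) E u
  have hv := mdifferentiableAt_extend 𝓘(ℝ, E) E v
  have h := hD x _ _ hu hv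
  have h' := hD' x _ _ hu hv
  rw [nablaJ, connection_eq_add_difference D D' hv,
    connection_eq_add_difference D D' (mdiffAt_J 𝓙 hv), map_add] at h
  rw [nablaJ, sub_eq_zero] at h'
  rw [h'] at h
  simp only [extend_apply_self] at h
  rw [← sub_eq_zero, ← h]
  abel

/-- The connection `Y ↦ (∇Y - J ∇(JY)) / 2`, for which `J` is parallel. -/
noncomputable def complexification (𝓙 : AlmostComplex E M) (D : Connection E M) :
    Connection E M where
  toFun Y x := (1 / 2 : ℝ) • (D Y x - (𝓙.J x).comp (D (fun y ↦ 𝓙.J y (Y y)) x))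
  isCovariantDerivativeOnUniv :=
    { add := fun {Y Y' x} hY hY' _ ↦ by
        have h : (fun y ↦ 𝓙.J y ((Y + Y') y)) =
            (fun y ↦ 𝓙.J y (Y y)) + fun y ↦ 𝓙.J y (Y' y) := by ext y; simp
        rw [h, D.isCovariantDerivativeOnUniv.add hY hY',
          D.isCovariantDerivativeOnUniv.add (mdiffAt_J 𝓙 hY) (mdiffAt_J 𝓙 hY')]
        ext1 u
        simp only [smul_apply, sub_apply, add_apply, ContinuousLinearMap.comp_apply, map_add]
        module
      leibniz := fun {Y f x} hY hf _ ↦ by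
        have h : (fun y ↦ 𝓙.J y ((f • Y) y)) = f • fun y ↦ 𝓙.J y (Y y) := by ext y; simp
        rw [h, D.isCovariantDerivativeOnUniv.leibniz hY hf,
          D.isCovariantDerivativeOnUniv.leibniz (mdiffAt_J 𝓙 hY) hf]
        -- Since `J² = -1`, the `df` term of `-J D(f JY)` is again `df ⊗ Y`; the factor `1/2` makes
        -- the two copies one.
        ext1 u
        simp only [smul_apply, sub_apply, add_apply, ContinuousLinearMap.comp_apply, map_add,
          ContinuousLinearMap.smulRight_apply, map_smul, 𝓙.sq]
        module }

theorem complexification_apply (𝓙 : AlmostComplex E M) (D : Connection E M)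
    (Y : Π y : M, TangentSpace 𝓘(ℝ, E) y) (x : M) (u : TangentSpace 𝓘(ℝ, E) x) :
    complexification 𝓙 D Y x u =
      (1 / 2 : ℝ) • (D Y x u - 𝓙.J x (D (fun y ↦ 𝓙.J y (Y y)) x u)) := rfl

theorem isComplex_complexification (𝓙 : AlmostComplex E M) (D : Connection E M) :
    IsComplex 𝓙 (complexification 𝓙 D) := by
  intro x X Y hX hY
  rw [nablaJ, complexification_apply, complexification_apply, connection_J_J D 𝓙 hY]
  simp only [neg_apply, map_neg, map_smul, map_sub, 𝓙.sq]
  module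

/-- The average of the metric identities for `(Y, Z)` and `(JY, JZ)`: the two functions
differentiated agree because `J` is an isometry. -/
theorem isMetric_complexification {g : PseudoMetric E M} {𝓙 : AlmostComplex E M}
    (h : IsAlmostHermitian g 𝓙) {D : Connection E M} (hD : IsMetric g D) :
    IsMetric g (complexification 𝓙 D) := by
  intro x Y Z hY hZ u
  have h1 := hD x Y Z hY hZ u
  have h2 := hD x _ _ (mdiffAt_J 𝓙 hY) (mdiffAt_J 𝓙 hZ) u
  simp only [h.compat] at h2
  rw [complexification_apply, complexification_apply]
  simp only [map_smul, map_sub, smul_apply, sub_apply, smul_eq_mul]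
  linarith [form_J_left h x (D (fun y ↦ 𝓙.J y (Y y)) x u) (Z x),
    form_J_left h x (Y x) (D (fun y ↦ 𝓙.J y (Z y)) x u)]

end Connection

/-- The difference of two metric connections is determined by their torsions; for a
skew-symmetric torsion and a torsion-free connection it is half the torsion. -/
theorem difference_eq_half_torsion {g : PseudoMetric E M} {D D' : Connection E M}
    (hD : IsMetric g D) (hD' : IsLeviCivita g D')
    (hT : ∀ (x : M) (u v w : TangentSpace 𝓘(ℝ, E) x),
      g.form x (D.torsion x u v) w = -g.form x (D.torsion x u w) v)
    (x : M) (u v : TangentSpace 𝓘(ℝ, E) x) :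
    D.difference D' x v u = (1 / 2 : ℝ) • D.torsion x u v := by
  have sk := form_difference_skew hD hD'.2 x
  have hs (a b c : TangentSpace 𝓘(ℝ, E) x) :
      g.form x (D.difference D' x b a) c - g.form x (D.difference D' x a b) c =
        g.form x (D.torsion x a b) c := by
    have := congr(g.form x $(difference_sub_swap D D' x a b) c)
    simpa [hD'.1] using this
  have hA (a b c : TangentSpace 𝓘(ℝ, E) x) :
      g.form x (D.torsion x a b) c = -g.form x (D.torsion x b a) c := by
    rw [D.torsion_antisymm]; simp
  refine form_ext g fun w ↦ ?_
  rw [map_smul, smul_apply, smul_eq_mul]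
  -- With `a(u,v,w) = g(A(u,v), w)` skew in `v, w` and `t` the torsion form, `2a(u,v,w) = t(u,v,w) -
  -- t(v,w,u) + t(w,u,v)`. For alternating `t` the three cyclic values coincide.
  linarith [hs u v w, hs v w u, hs w u v, sk u v w, sk v w u, sk w u v, hT x u v w, hT x v w u,
    hT x w u v, hA u v w, hA v w u, hA w u v, g.symm x (D.difference D' x v u) w,
    g.symm x v (D.difference D' x w u), g.symm x w (D.difference D' x u v),
    g.symm x u (D.difference D' x v w)]

/-! ### Characteristic connections on nearly Kähler manifolds. -/

section Characteristic

variable {g : PseudoMetric E M} {𝓙 : AlmostComplex E M}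

theorem difference_leviCivita {D : Connection E M} (hD : IsCharacteristic g 𝓙 D) (x : M)
    (u v : TangentSpace 𝓘(ℝ, E) x) :
    D.difference (leviCivita g) x v u = (1 / 2 : ℝ) • D.torsion x u v :=
  difference_eq_half_torsion hD.metric (isLeviCivita_leviCivita g) hD.skew x u v

theorem sub_leviCivita {D : Connection E M} (hD : IsCharacteristic g 𝓙 D) {x : M}
    {Y : Π y : M, TangentSpace 𝓘(ℝ, E) y} (hY : MDiffAt (T% Y) x)
    (u : TangentSpace 𝓘(ℝ, E) x) :
    D Y x u - leviCivita g Y x u = (1 / 2 : ℝ) • D.torsion x u (Y x) := by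
  rw [connection_eq_add_difference D (leviCivita g) hY, add_sub_cancel_left,
    difference_leviCivita hD]

/-- `(∇_X J) Y = (J T(X, Y) - T(X, JY)) / 2` for the Levi-Civita connection `∇` and the torsion
`T` of a characteristic connection. -/
theorem nablaJ_leviCivita {D : Connection E M} (hD : IsCharacteristic g 𝓙 D) {x : M}
    {X Y : Π y : M, TangentSpace 𝓘(ℝ, E) y} (hX : MDiffAt (T% X) x) (hY : MDiffAt (T% Y) x) :
    nablaJ (leviCivita g) 𝓙 X Y x =
      (1 / 2 : ℝ) • (𝓙.J x (D.torsion x (X x) (Y x)) - D.torsion x (X x) (𝓙.J x (Y x))) := by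
  have h := hD.complex x X Y hX hY
  rw [nablaJ, connection_eq_add_difference D (leviCivita g) hY,
    connection_eq_add_difference D (leviCivita g) (mdiffAt_J 𝓙 hY), difference_leviCivita hD,
    difference_leviCivita hD, map_add, map_smul] at h
  rw [nablaJ, ← sub_eq_zero, ← h]
  module

/-- In the nearly Kähler identity expressed through `T`, the terms `J T(u, v)` and `J T(v, u)`
cancel and only this relation remains. -/
theorem torsion_J_swap (hNK : IsNearlyKahler g 𝓙) {D : Connection E M}
    (hD : IsCharacteristic g 𝓙 D) (x : M) (u v : TangentSpace 𝓘(ℝ, E) x) :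
    D.torsion x u (𝓙.J x v) = D.torsion x (𝓙.J x u) v := by
  have hu := mdifferentiableAt_extend 𝓘(ℝ, E) E u
  have hv := mdifferentiableAt_extend 𝓘(ℝ, E) E v
  have h := hNK.skew x _ _ hu hv
  rw [nablaJ_leviCivita hD hu hv, nablaJ_leviCivita hD hv hu] at h
  simp only [extend_apply_self] at h
  rw [D.torsion_antisymm v u, D.torsion_antisymm v, map_neg] at h
  rw [← sub_eq_zero]
  have : D.torsion x u (𝓙.J x v) - D.torsion x (𝓙.J x u) v = (-2 : ℝ) •
    ((1 / 2 : ℝ) • (𝓙.J x (D.torsion x u v) - D.torsion x u (𝓙.J x v)) -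
      -((1 / 2 : ℝ) • (-𝓙.J x (D.torsion x u v) - -D.torsion x (𝓙.J x u) v))) := by module
  rw [this, h, sub_self, smul_zero]

/-- By swapping `J` and using skewness in the last two slots, `g(T(u,Jv),w) = g(T(Ju,v),w) =
-g(T(Ju,w),v) = -g(T(u,Jw),v) = g(T(u,v),Jw)`, and `J` is skew for `g`. -/
theorem torsion_J_right (hNK : IsNearlyKahler g 𝓙) {D : Connection E M}
    (hD : IsCharacteristic g 𝓙 D) (x : M) (u v : TangentSpace 𝓘(ℝ, E) x) :
    D.torsion x u (𝓙.J x v) = -𝓙.J x (D.torsion x u v) := by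
  refine form_ext g fun w ↦ ?_
  rw [map_neg, neg_apply, form_J_left hNK.toIsAlmostHermitian, torsion_J_swap hNK hD, hD.skew,
    ← torsion_J_swap hNK hD, hD.skew]

theorem torsion_J_J (hNK : IsNearlyKahler g 𝓙) {D : Connection E M}
    (hD : IsCharacteristic g 𝓙 D) (x : M) (u v : TangentSpace 𝓘(ℝ, E) x) :
    D.torsion x (𝓙.J x u) (𝓙.J x v) = -D.torsion x u v := by
  rw [← torsion_J_swap hNK hD, 𝓙.sq, map_neg]

theorem IsCharacteristic.isNijenhuisType (hNK : IsNearlyKahler g 𝓙) {D : Connection E M}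
    (hD : IsCharacteristic g 𝓙 D) : IsNijenhuisType 𝓙 D :=
  ⟨hD.complex, fun x u v ↦ by simp [part11, torsion_J_J hNK hD]⟩

theorem nablaJ_J_eq_torsion (hNK : IsNearlyKahler g 𝓙) {D : Connection E M}
    (hD : IsCharacteristic g 𝓙 D) {x : M} {X Y : Π y : M, TangentSpace 𝓘(ℝ, E) y}
    (hX : MDiffAt (T% X) x) (hY : MDiffAt (T% Y) x) :
    nablaJ (leviCivita g) 𝓙 X (fun y ↦ 𝓙.J y (Y y)) x = D.torsion x (X x) (Y x) := by
  rw [nablaJ_leviCivita hD hX (mdiffAt_J 𝓙 hY)]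
  simp only [torsion_J_right hNK hD, map_neg, 𝓙.sq]
  module

theorem nijenhuis_eq_torsion (hNK : IsNearlyKahler g 𝓙) {D : Connection E M}
    (hD : IsCharacteristic g 𝓙 D) {x : M} {X Y : Π y : M, TangentSpace 𝓘(ℝ, E) y}
    (hX : MDiffAt (T% X) x) (hY : MDiffAt (T% Y) x) :
    nijenhuis 𝓙 X Y x = (4 : ℝ) • D.torsion x (X x) (Y x) := by
  have hb {V W : Π y : M, TangentSpace 𝓘(ℝ, E) y} (hV : MDiffAt (T% V) x)
      (hW : MDiffAt (T% W) x) : mlieBracket 𝓘(ℝ, E) V W x =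
        D W x (V x) - D V x (W x) - D.torsion x (V x) (W x) := by
    rw [D.torsion_apply hV hW]; abel
  have hc {V W : Π y : M, TangentSpace 𝓘(ℝ, E) y} (hV : MDiffAt (T% V) x)
      (hW : MDiffAt (T% W) x) :
      D (fun y ↦ 𝓙.J y (W y)) x (V x) = 𝓙.J x (D W x (V x)) :=
    sub_eq_zero.1 (hD.complex x V W hV hW)
  have hJX := mdiffAt_J 𝓙 hX
  have hJY := mdiffAt_J 𝓙 hY
  -- With `J` parallel all derivative terms cancel, leaving `-T(JX,JY) + T(X,Y) + J T(X,JY) + J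
  -- T(JX,Y)`; each summand equals `T(X,Y)`.
  rw [nijenhuis, hb hJX hJY, hb hX hY, hb hX hJY, hb hJX hY, hc hJX hY, hc hJY hX, hc hX hY,
    hc hY hX]
  simp only [torsion_J_J hNK hD, ← torsion_J_swap hNK hD, torsion_J_right hNK hD, map_sub, map_neg,
    𝓙.sq]
  module

theorem isCharacteristic_complexification (hNK : IsNearlyKahler g 𝓙) :
    IsCharacteristic g 𝓙 (complexification 𝓙 (leviCivita g)) where
  complex := isComplex_complexification 𝓙 _
  metric := isMetric_complexification hNK.toIsAlmostHermitian (isLeviCivita_leviCivita g).2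
  skew x u v w := by
    have hdiff (a b : TangentSpace 𝓘(ℝ, E) x) :
        (complexification 𝓙 (leviCivita g)).difference (leviCivita g) x b a =
          -((1 / 2 : ℝ) • 𝓙.J x (nablaJ (leviCivita g) 𝓙 (extend E a) (extend E b) x)) := by
      have h := connection_eq_add_difference (complexification 𝓙 (leviCivita g)) (leviCivita g)
        (mdifferentiableAt_extend 𝓘(ℝ, E) E b) a
      rw [extend_apply_self, complexification_apply] at h
      rw [← sub_eq_iff_eq_add'.2 h, nablaJ, map_sub, 𝓙.sq, extend_apply_self]
      module
    -- The difference tensor is skew by the nearly Kähler condition, so antisymmetrizing it doubles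
    -- it.
    have hT (a b : TangentSpace 𝓘(ℝ, E) x) :
        (complexification 𝓙 (leviCivita g)).torsion x a b =
          (2 : ℝ) • (complexification 𝓙 (leviCivita g)).difference (leviCivita g) x b a := by
      have h := difference_sub_swap (complexification 𝓙 (leviCivita g)) (leviCivita g) x a b
      rw [(isLeviCivita_leviCivita g).1] at h
      simp only [Pi.zero_apply, zero_apply, sub_zero] at h
      rw [← h, hdiff, hdiff, hNK.skew x _ _ (mdifferentiableAt_extend 𝓘(ℝ, E) E b)
        (mdifferentiableAt_extend 𝓘(ℝ, E) E a), map_neg]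
      module
    have h := form_difference_skew
      (isMetric_complexification hNK.toIsAlmostHermitian (isLeviCivita_leviCivita g).2)
      (isLeviCivita_leviCivita g).2 x u v w
    rw [hT, hT, map_smul, map_smul, smul_apply, smul_apply, h, g.symm, smul_neg]

end Characteristic

/-! ### Metric traces and the `(1,1)`-part. -/

section Trace

variable {g : PseudoMetric E M} {𝓙 : AlmostComplex E M} {x : M} {W : Type*} [AddCommGroup W]
  [Module ℝ W]

theorem metricTrace_eq_zero_of_skew (B : TangentSpace 𝓘(ℝ, E) x → TangentSpace 𝓘(ℝ, E) x → W)
    (hB : ∀ u v, B u v = -B v u) : metricTrace g x B = 0 := by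
  set b := Module.finBasis ℝ (TangentSpace 𝓘(ℝ, E) x)
  set G : Matrix _ _ ℝ := Matrix.of fun k l ↦ g.form x (b k) (b l)
  have hGT : G.transpose = G := by ext i j; simp [G, g.symm x (b i)]
  have hinv (i j) : G⁻¹ i j = G⁻¹ j i := by
    conv_lhs => rw [← hGT, ← Matrix.transpose_nonsing_inv]
    rfl
  have h : metricTrace g x B = -metricTrace g x B := by
    change ∑ i, ∑ j, G⁻¹ i j • B (b i) (b j) = -∑ i, ∑ j, G⁻¹ i j • B (b i) (b j)
    conv_lhs => rw [Finset.sum_comm]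
    simp only [← Finset.sum_neg_distrib]
    refine Finset.sum_congr rfl fun i _ ↦ Finset.sum_congr rfl fun j _ ↦ ?_
    rw [hinv, hB, smul_neg]
  have h2 : (2 : ℝ) • metricTrace g x B = 0 := by
    rw [two_smul]; nth_rw 1 [h]; exact neg_add_cancel _
  exact (smul_eq_zero.1 h2).resolve_left two_ne_zero

/-- An isometry preserves the inverse metric. In matrices, `PᵀGP = G` is inverted, and `P² = -1`
gives `P⁻¹ = -P`, whose two signs cancel. -/
theorem metricTrace_J (h : IsAlmostHermitian g 𝓙)
    (B : TangentSpace 𝓘(ℝ, E) x →ₗ[ℝ] TangentSpace 𝓘(ℝ, E) x →ₗ[ℝ] W) :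
    metricTrace g x (fun u v ↦ B (𝓙.J x u) (𝓙.J x v)) = metricTrace g x fun u v ↦ B u v := by
  set b := Module.finBasis ℝ (TangentSpace 𝓘(ℝ, E) x)
  set G : Matrix _ _ ℝ := Matrix.of fun k l ↦ g.form x (b k) (b l)
  set P : Matrix _ _ ℝ := Matrix.of fun k i ↦ b.repr (𝓙.J x (b i)) k
  have hJ (i) : 𝓙.J x (b i) = ∑ k, P k i • b k := (b.sum_repr _).symm
  have hPP : P * P = -1 := by
    ext k i
    have := congr(b.repr $(𝓙.sq x (b i)) k)
    rw [hJ i, map_sum, map_sum, Finset.sum_apply'] at this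
    simp only [map_smul, map_neg, Module.Basis.repr_self, Finsupp.coe_smul, Finsupp.coe_neg,
      Pi.smul_apply, Pi.neg_apply, smul_eq_mul] at this
    rw [Matrix.mul_apply, Matrix.neg_apply, Matrix.one_apply]
    rw [Finsupp.single_apply] at this
    simp only [eq_comm (a := k), ← this, P, Matrix.of_apply, mul_comm]
  have hPGP : P.transpose * G * P = G := by
    ext i j
    have := h.compat x (b i) (b j)
    rw [hJ i, hJ j] at this
    simp only [map_sum, map_smul, sum_apply, smul_apply, smul_eq_mul] at this
    simp only [Matrix.mul_apply, Matrix.transpose_apply, Finset.sum_mul]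
    simp only [G, Matrix.of_apply, ← this, Finset.mul_sum]
    refine Finset.sum_congr rfl fun _ _ ↦ Finset.sum_congr rfl fun _ _ ↦ by ring
  have hPi : P⁻¹ = -P := Matrix.inv_eq_right_inv (by rw [mul_neg, hPP, neg_neg])
  have hPG : P * G⁻¹ * P.transpose = G⁻¹ := by
    have := congr($hPGP⁻¹)
    rw [Matrix.mul_inv_rev, Matrix.mul_inv_rev, ← Matrix.transpose_nonsing_inv, hPi] at this
    simpa [mul_assoc] using this
  change ∑ i, ∑ j, G⁻¹ i j • B (𝓙.J x (b i)) (𝓙.J x (b j)) = ∑ k, ∑ l, G⁻¹ k l • B (b k) (b l)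
  simp only [hJ]
  simp only [map_sum, map_smul, LinearMap.sum_apply, LinearMap.smul_apply, Finset.smul_sum,
    smul_smul]
  conv_rhs => rw [← hPG]
  simp only [Matrix.mul_apply, Matrix.transpose_apply, Finset.sum_mul, Finset.sum_smul]
  rw [sum_sum_sum_sum_reverse]
  refine Finset.sum_congr rfl fun _ _ ↦ Finset.sum_congr rfl fun _ _ ↦
    Finset.sum_congr rfl fun _ _ ↦ Finset.sum_congr rfl fun _ _ ↦ ?_
  congr 1
  ring

/-- The trace of a bilinear map is zero if its part of type `(1, 1)` is skew-symmetric. -/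
theorem metricTrace_eq_zero (h : IsAlmostHermitian g 𝓙)
    (B : TangentSpace 𝓘(ℝ, E) x →ₗ[ℝ] TangentSpace 𝓘(ℝ, E) x →ₗ[ℝ] W)
    (hB : ∀ u, B u u + B (𝓙.J x u) (𝓙.J x u) = 0) : metricTrace g x (fun u v ↦ B u v) = 0 := by
  have h1 : metricTrace g x (fun u v ↦ B u v + B (𝓙.J x u) (𝓙.J x v)) = 0 := by
    refine metricTrace_eq_zero_of_skew _ fun u v ↦ ?_
    -- Polarization: a bilinear map vanishing on the diagonal is skew.
    have := hB (u + v)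
    simp only [map_add, LinearMap.add_apply] at this
    linear_combination (norm := module) this - hB u - hB v
  have h2 : metricTrace g x (fun u v ↦ B u v + B (𝓙.J x u) (𝓙.J x v)) =
      (2 : ℝ) • metricTrace g x fun u v ↦ B u v := by
    rw [two_smul]
    nth_rw 2 [← metricTrace_J h B]
    simp only [metricTrace, smul_add, Finset.sum_add_distrib]
  rw [h1] at h2
  exact (smul_eq_zero.1 h2.symm).resolve_left two_ne_zero

/-- Complex connections of Nijenhuis type differ by a tensor `S` with `S(Ju, Ju) = -S(u, u)`. -/
theorem difference_self_add_J {D D' : Connection E M} (hD : IsNijenhuisType 𝓙 D)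
    (hD' : IsNijenhuisType 𝓙 D') (u : TangentSpace 𝓘(ℝ, E) x) :
    D.difference D' x u u + D.difference D' x (𝓙.J x u) (𝓙.J x u) = 0 := by
  have hS := difference_J hD.1 hD'.1 x
  have h := hD.2 x u (𝓙.J x u)
  have h' := hD'.2 x u (𝓙.J x u)
  have e := difference_sub_swap D D' x u (𝓙.J x u)
  -- The left sides of `e` and `e'` agree once `J² = -1` is used, and their right sides add up to
  -- twice the `(1,1)`-part of the torsion difference at `(u, Ju)`, which is zero.
  have e' := difference_sub_swap D D' x (𝓙.J x u) (𝓙.J x (𝓙.J x u))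
  simp only [part11, 𝓙.sq, map_neg, neg_apply, hS] at h h' e e'
  have key : 𝓙.J x (D.difference D' x u u) = D.difference D' x u (𝓙.J x u) := by
    linear_combination (norm := module) (1 / 2 : ℝ) • (e + e') + h - h'
  rw [hS, ← key, 𝓙.sq, add_neg_cancel]

end Trace

end Source

/-! ### Second fundamental form of a map and harmonicity. -/

section Maps

variable {E : Type*} [NormedAddCommGroup E] [NormedSpace ℝ E] [FiniteDimensional ℝ E]
  {M : Type*} [TopologicalSpace M] [ChartedSpace E M] [IsManifold 𝓘(ℝ, E) ∞ M]
  {F : Type*} [NormedAddCommGroup F] [NormedSpace ℝ F] [FiniteDimensional ℝ F]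
  {N : Type*} [TopologicalSpace N] [ChartedSpace F N] [IsManifold 𝓘(ℝ, F) ∞ N]

/-- Linearity of the extension holds only over the base set of the trivialization; an identity near
`x` suffices for derivatives at `x`. -/
theorem extend_smul_add_eventually {x : M} (a : ℝ) (u v : TangentSpace 𝓘(ℝ, E) x) :
    ∀ᶠ y in 𝓝 x, extend E (a • u + v) y = (a • extend E u + extend E v) y := by
  set t := trivializationAt E (fun z : M ↦ TangentSpace 𝓘(ℝ, E) z) x with ht
  have hx : x ∈ t.baseSet := mem_baseSet_trivializationAt' x
  filter_upwards [t.open_baseSet.mem_nhds hx] with y hy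
  have hl (w : TangentSpace 𝓘(ℝ, E) x) : (t ⟨x, w⟩).2 = t.linearMapAt ℝ x w := by
    rw [t.coe_linearMapAt_of_mem hx]
  simp only [extend, ← ht, Pi.add_apply, Pi.smul_apply, ← t.symmL_apply (R := ℝ) hy, hl, map_add,
    map_smul]

theorem connection_extend_smul_add (D : Connection E M) {x : M} (a : ℝ)
    (u v : TangentSpace 𝓘(ℝ, E) x) :
    D (extend E (a • u + v)) x = a • D (extend E u) x + D (extend E v) x := by
  have hu := mdifferentiableAt_extend 𝓘(ℝ, E) E u
  have hv := mdifferentiableAt_extend 𝓘(ℝ, E) E v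
  have hau : MDiffAt (T% (a • extend E u)) x := mdifferentiableAt_const.smul_section hu
  rw [D.isCovariantDerivativeOnUniv.congr_of_eventuallyEq
    (mdifferentiableAt_extend 𝓘(ℝ, E) E (a • u + v)) (mdifferentiableAt_add_section hau hv)
    Filter.univ_mem (extend_smul_add_eventually a u v),
    D.isCovariantDerivativeOnUniv.add hau hv, D.isCovariantDerivativeOnUniv.smul_const a hu]

theorem pullbackConnection_smul_add (D : Connection F N) {φ : M → N} {x : M}
    {s s' s'' : Π y : M, TangentSpace 𝓘(ℝ, F) (φ y)} (a : ℝ)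
    (hs : MDifferentiableAt 𝓘(ℝ, E) (𝓘(ℝ, F).prod 𝓘(ℝ, F))
      (fun y ↦ TotalSpace.mk' F (E := fun z : N ↦ TangentSpace 𝓘(ℝ, F) z) (φ y) (s y)) x)
    (hs' : MDifferentiableAt 𝓘(ℝ, E) (𝓘(ℝ, F).prod 𝓘(ℝ, F))
      (fun y ↦ TotalSpace.mk' F (E := fun z : N ↦ TangentSpace 𝓘(ℝ, F) z) (φ y) (s' y)) x)
    (h : ∀ᶠ y in 𝓝 x, s'' y = a • s y + s' y) :
    pullbackConnection (E := E) D φ s'' x =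
      a • pullbackConnection (E := E) D φ s x + pullbackConnection (E := E) D φ s' x := by
  set t := trivializationAt F (fun z : N ↦ TangentSpace 𝓘(ℝ, F) z) (φ x)
  have hφ : MDifferentiableAt 𝓘(ℝ, E) 𝓘(ℝ, F) φ x := ((mdifferentiableAt_totalSpace ..).1 hs).1
  have h1 : MDiffAt (fun y ↦ (t (TotalSpace.mk' F (φ y) (s y))).2) x :=
    ((mdifferentiableAt_totalSpace ..).1 hs).2
  have h2 : MDiffAt (fun y ↦ (t (TotalSpace.mk' F (φ y) (s' y))).2) x :=
    ((mdifferentiableAt_totalSpace ..).1 hs').2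
  have hx : φ x ∈ t.baseSet := mem_baseSet_trivializationAt' (φ x)
  have he : (fun y ↦ (t (TotalSpace.mk' F (φ y) (s'' y))).2) =ᶠ[𝓝 x]
      (fun _ : M ↦ a) • (fun y ↦ (t (TotalSpace.mk' F (φ y) (s y))).2) +
        fun y ↦ (t (TotalSpace.mk' F (φ y) (s' y))).2 := by
    -- Continuity of `φ` keeps `φ y` in the base set, where the trivialization is fibrewise linear.
    filter_upwards [h, hφ.continuousAt.preimage_mem_nhds (t.open_baseSet.mem_nhds hx)] with y hy hty
    have hl (w : TangentSpace 𝓘(ℝ, F) (φ y)) :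
        (t (TotalSpace.mk' F (φ y) w)).2 = t.linearMapAt ℝ (φ y) w := by
      rw [t.coe_linearMapAt_of_mem hty]
    simp only [Pi.add_apply, Pi.smul_apply', hl, hy, map_add, map_smul]
  have hd : mvfderiv 𝓘(ℝ, E) (fun y ↦ (t (TotalSpace.mk' F (φ y) (s'' y))).2) x =
      a • mvfderiv 𝓘(ℝ, E) (fun y ↦ (t (TotalSpace.mk' F (φ y) (s y))).2) x +
        mvfderiv 𝓘(ℝ, E) (fun y ↦ (t (TotalSpace.mk' F (φ y) (s' y))).2) x := by
    have hc : mvfderiv 𝓘(ℝ, E) (fun y ↦ (t (TotalSpace.mk' F (φ y) (s'' y))).2) x =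
        mvfderiv 𝓘(ℝ, E) ((fun _ : M ↦ a) • (fun y ↦ (t (TotalSpace.mk' F (φ y) (s y))).2) +
          fun y ↦ (t (TotalSpace.mk' F (φ y) (s' y))).2) x := by
      ext u
      simp only [mvfderiv, he.mfderiv_eq]
      rfl
    rw [hc, mvfderiv_add (mdifferentiableAt_const.smul h1) h2,
      mvfderiv_smul mdifferentiableAt_const h1]
    ext u
    simp [mvfderiv_const]
  rw [pullbackConnection, hd, h.self_of_nhds, connection_extend_smul_add]
  ext1 u
  simp only [pullbackConnection, add_apply, smul_apply, ContinuousLinearMap.comp_apply,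
    map_add, map_smul]
  module

theorem mdifferentiableAt_mfderiv_extend {φ : M → N} (hφ : ContMDiff 𝓘(ℝ, E) 𝓘(ℝ, F) ∞ φ) {x : M}
    (v : TangentSpace 𝓘(ℝ, E) x) :
    MDifferentiableAt 𝓘(ℝ, E) (𝓘(ℝ, F).prod 𝓘(ℝ, F))
      (fun y ↦ TotalSpace.mk' F (E := fun z : N ↦ TangentSpace 𝓘(ℝ, F) z) (φ y)
        (mfderiv 𝓘(ℝ, E) 𝓘(ℝ, F) φ y (extend E v y))) x := by
  -- The section is the tangent map of `φ` composed with the extended field.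
  have h := (hφ.contMDiff_tangentMap (m := 1) (by norm_cast)).mdifferentiableAt (by simp)
    (x := (⟨x, extend E v x⟩ : TangentBundle 𝓘(ℝ, E) M))
  exact h.comp x (mdifferentiableAt_extend 𝓘(ℝ, E) E v)

/-- `∇dφ` as a bilinear map. -/
noncomputable def nablaDiffHom (D : Connection E M) (D' : Connection F N) {φ : M → N}
    (hφ : ContMDiff 𝓘(ℝ, E) 𝓘(ℝ, F) ∞ φ) (x : M) :
    TangentSpace 𝓘(ℝ, E) x →ₗ[ℝ] TangentSpace 𝓘(ℝ, E) x →ₗ[ℝ] TangentSpace 𝓘(ℝ, F) (φ x) :=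
  have key (a : ℝ) (u v w : TangentSpace 𝓘(ℝ, E) x) : nablaDiff D D' φ x w (a • u + v) =
      a • nablaDiff D D' φ x w u + nablaDiff D D' φ x w v := by
    rw [nablaDiff, connection_extend_smul_add, pullbackConnection_smul_add D' a
      (mdifferentiableAt_mfderiv_extend hφ u) (mdifferentiableAt_mfderiv_extend hφ v)]
    · simp only [nablaDiff, add_apply, smul_apply, map_add, map_smul]
      module
    · filter_upwards [extend_smul_add_eventually a u v] with y hy
      simp [hy]
  LinearMap.mk₂ ℝ (nablaDiff D D' φ x)
    (fun u v w ↦ by simp only [nablaDiff, map_add]; abel)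
    (fun c u w ↦ by simp only [nablaDiff, map_smul, smul_sub])
    (fun w u v ↦ by simpa using key 1 u v w)
    (fun c w u ↦ by
      -- At `a = 1` with both vectors zero, `key` reads `n = n + n`.
      have h0 : nablaDiff D D' φ x w 0 = 0 := by simpa using key 1 0 0 w
      simpa [h0] using key c u 0 w)

theorem nablaDiffHom_apply (D : Connection E M) (D' : Connection F N) {φ : M → N}
    (hφ : ContMDiff 𝓘(ℝ, E) 𝓘(ℝ, F) ∞ φ) (x : M) (u v : TangentSpace 𝓘(ℝ, E) x) :
    nablaDiffHom D D' hφ x u v = nablaDiff D D' φ x u v := rfl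

theorem nablaDiff_eq_add_difference (D₁ D₂ : Connection E M) (D' : Connection F N) (φ : M → N)
    (x : M) (u v : TangentSpace 𝓘(ℝ, E) x) :
    nablaDiff D₂ D' φ x u v =
      nablaDiff D₁ D' φ x u v + mfderiv 𝓘(ℝ, E) 𝓘(ℝ, F) φ x (D₁.difference D₂ x v u) := by
  rw [nablaDiff, nablaDiff,
    connection_eq_add_difference D₁ D₂ (mdifferentiableAt_extend 𝓘(ℝ, E) E v), map_add,
    extend_apply_self]
  abel

theorem IsGeneralizedPluriharmonic.isHarmonic {g : PseudoMetric E M} {𝓙 : AlmostComplex E M}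
    (hNK : IsNearlyKahler g 𝓙) {h : PseudoMetric F N} {φ : M → N}
    (hφ : ContMDiff 𝓘(ℝ, E) 𝓘(ℝ, F) ∞ φ) (hp : IsGeneralizedPluriharmonic 𝓙 h φ) :
    IsHarmonic g h φ := by
  obtain ⟨D, hD, hpl⟩ := hp
  intro x
  have hC := isCharacteristic_complexification hNK
  refine metricTrace_eq_zero hNK.toIsAlmostHermitian
    (nablaDiffHom (leviCivita g) (leviCivita h) hφ x) fun u ↦ ?_
  simp only [nablaDiffHom_apply]
  -- On the diagonal the correction is `dφ(T(w, w)/2) = 0`, so a characteristic connection may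
  -- replace Levi-Civita.
  have hself (w : TangentSpace 𝓘(ℝ, E) x) : nablaDiff (leviCivita g) (leviCivita h) φ x w w =
      nablaDiff (complexification 𝓙 (leviCivita g)) (leviCivita h) φ x w w := by
    rw [nablaDiff_eq_add_difference (complexification 𝓙 (leviCivita g)) (leviCivita g),
      difference_leviCivita hC, CovariantDerivative.torsion_self, smul_zero, map_zero, add_zero]
  have hS := congr(mfderiv 𝓘(ℝ, E) 𝓘(ℝ, F) φ x
    $(difference_self_add_J hD (hC.isNijenhuisType hNK) u))
  rw [map_add, map_zero] at hS
  have hDu := hpl x u u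
  rw [part11, smul_eq_zero_iff_right (by norm_num)] at hDu
  simp only [hself, nablaDiff_eq_add_difference D (complexification 𝓙 (leviCivita g))]
  rw [add_add_add_comm, hDu, hS, add_zero]

end Maps

end NearlyKahler

/-! ### The main theorem. -/

theorem mainTheorem10
    {E : Type*} [NormedAddCommGroup E] [NormedSpace ℝ E] [FiniteDimensional ℝ E]
    {M : Type*} [TopologicalSpace M] [T2Space M] [SecondCountableTopology M]
    [ChartedSpace E M] [IsManifold 𝓘(ℝ, E) ∞ M]
    (g : NearlyKahler.PseudoMetric E M) (𝓙 : NearlyKahler.AlmostComplex E M)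
    (hNK : NearlyKahler.IsNearlyKahler g 𝓙) :
    (∃ D : NearlyKahler.Connection E M, NearlyKahler.IsCharacteristic g 𝓙 D) ∧
    (∀ D : NearlyKahler.Connection E M, NearlyKahler.IsCharacteristic g 𝓙 D →
      -- `N_J(X, Y) = 4 (∇_X J) J Y = 4 T(X, Y)`
      (∀ (x : M) (X Y : Π y : M, TangentSpace 𝓘(ℝ, E) y), MDiffAt (T% X) x → MDiffAt (T% Y) x →
        NearlyKahler.nijenhuis 𝓙 X Y x
            = (4 : ℝ) • NearlyKahler.nablaJ (NearlyKahler.leviCivita g) 𝓙 X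
                (fun y ↦ 𝓙.J y (Y y)) x ∧
        NearlyKahler.nijenhuis 𝓙 X Y x = (4 : ℝ) • D.torsion x (X x) (Y x)) ∧
      -- `D` is a complex connection of Nijenhuis type
      NearlyKahler.IsNijenhuisType 𝓙 D ∧
      -- the difference tensor `D - ∇` is half the torsion, is skew-symmetric, and is trace-free
      (∀ (x : M) (X Y : Π y : M, TangentSpace 𝓘(ℝ, E) y), MDiffAt (T% X) x → MDiffAt (T% Y) x →
        D Y x (X x) - NearlyKahler.leviCivita g Y x (X x)
            = (1 / 2 : ℝ) • D.torsion x (X x) (Y x) ∧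
        D Y x (X x) - NearlyKahler.leviCivita g Y x (X x)
            = -(D X x (Y x) - NearlyKahler.leviCivita g X x (Y x))) ∧
      (∀ x : M, NearlyKahler.metricTrace g x (fun u v ↦
        NearlyKahler.leviCivita g (FiberBundle.extend E v) x u
          - D (FiberBundle.extend E v) x u) = 0)) ∧
    -- every generalized pluriharmonic map is harmonic
    (∀ {F : Type*} [NormedAddCommGroup F] [NormedSpace ℝ F] [FiniteDimensional ℝ F]
      {N : Type*} [TopologicalSpace N] [T2Space N] [SecondCountableTopology N]
      [ChartedSpace F N] [IsManifold 𝓘(ℝ, F) ∞ N]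
      (h : NearlyKahler.PseudoMetric F N) (φ : M → N),
      ContMDiff 𝓘(ℝ, E) 𝓘(ℝ, F) ∞ φ →
      NearlyKahler.IsGeneralizedPluriharmonic 𝓙 h φ → NearlyKahler.IsHarmonic g h φ) := by
  refine ⟨⟨_, NearlyKahler.isCharacteristic_complexification hNK⟩, fun D hD ↦ ⟨fun x X Y hX hY ↦ ?_,
    hD.isNijenhuisType hNK, fun x X Y hX hY ↦ ⟨NearlyKahler.sub_leviCivita hD hY _, ?_⟩, fun x ↦ ?_⟩,
    fun h φ hφ hp ↦ hp.isHarmonic hNK hφ⟩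
  · rw [NearlyKahler.nablaJ_J_eq_torsion hNK hD hX hY,
      NearlyKahler.nijenhuis_eq_torsion hNK hD hX hY]
    exact ⟨rfl, rfl⟩
  · rw [NearlyKahler.sub_leviCivita hD hY, NearlyKahler.sub_leviCivita hD hX, D.torsion_antisymm,
      smul_neg]
  -- The traced map is `-T/2`, hence skew.
  · refine NearlyKahler.metricTrace_eq_zero_of_skew _ fun u v ↦ ?_
    rw [← neg_sub, NearlyKahler.sub_leviCivita hD (mdifferentiableAt_extend 𝓘(ℝ, E) E v),
      ← neg_sub (D _ x v), NearlyKahler.sub_leviCivita hD (mdifferentiableAt_extend 𝓘(ℝ, E) E u), extend_apply_self,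
      extend_apply_self, D.torsion_antisymm, smul_neg]
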